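/- Let $n \ge 0$ be an integer, $N=\{1,\dots,n\}$, and let $f:2^N\to\mathbb R$ be a set function, identified with a function on $\{0,1\}^n$ by identifying $x\in\{0,1\}^n$ with the set $\{i : x_i=1\}$. Suppose that $f$ is non-negative, that $f$ is submodular, i.e. $f(A\cup B)+f(A\cap B)\le f(A)+f(B)$ for all $A,B\subseteq N$, and that all its marginal values $f(A\cup\{j\})-f(A)$ ($A\subseteq N$, $j\in N$) lie in $[-1,1]$. Let $X_1,\dots,X_n$ be independent random variables with values in $\{0,1\}$ (not necessarily identically distributed), and let $Z=f(X_1,\dots,X_n)$. Then for every $\delta>0$, $$\Pr\bigl[Z\ge(1+\delta)\,\mathbf E[Z]\bigr]\le e^{-\delta^2\,\mathbf E[Z]/(4+5\delta/3)} \qquad\text{and}\qquad \Pr\bigl[Z\le(1-\delta)\,\mathbf E[Z]\bigr]\le e^{-\delta^2\,\mathbf E[Z]/4}.$$ -/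

import Mathlib

open MeasureTheory ProbabilityTheory

/-- A set function `f : 2^N → ℝ` is submodular if
`f (A ∪ B) + f (A ∩ B) ≤ f A + f B` for all `A, B ⊆ N`. -/
def IsSubmodular {N : Type*} [DecidableEq N] (f : Finset N → ℝ) : Prop :=
  ∀ A B : Finset N, f (A ∪ B) + f (A ∩ B) ≤ f A + f B

/-- The marginal value `f_A(j) = f (A ∪ {j}) - f A` of `j` with respect to `A`. -/
def marginalValue {N : Type*} [DecidableEq N] (f : Finset N → ℝ) (A : Finset N) (j : N) : ℝ :=
  f (A ∪ {j}) - f A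

/-- The value `f (x₁, …, xₙ)` of a set function at a point of the hypercube `{0,1}ⁿ`, which is
identified with the set of coordinates `i` such that `xᵢ = 1` (here `true`). -/
def evalCube {n : ℕ} (f : Finset (Fin n) → ℝ) (x : Fin n → Bool) : ℝ :=
  f (Finset.univ.filter fun i => x i = true)

/-!
The proof is the entropy method. Let `Z = f(X)`, `E = 𝔼[Z]`, `φ(x) = exp x - x - 1`, and let
`K(l) = log 𝔼[exp (l Z)]` be the cumulant generating function.

Submodularity and nonnegativity make `f` self-bounding: if `fᵢ(S)` is the smaller of the two values
obtained from `f(S)` by varying the membership of `i`, then `0 ≤ f - fᵢ ≤ 1` (the marginal values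
lie in `[-1, 1]`) and `∑ᵢ (f - fᵢ) ≤ 2 f` (`sum_sub_coordMin_le`).

The entropy `Ent(Y) = 𝔼[Y log Y] - 𝔼[Y] log 𝔼[Y]` is convex in `Y`, so for independent
coordinates it is at most the expected sum of the coordinatewise entropies
(`entropy_tensorization`). For `Y = exp (l f)` the entropy in the coordinate `i` is at most
`φ(-l) 𝔼[(f - fᵢ) exp (l f)]` (`twoPointEntropy_exp_le`); summing over `i` and using the
self-bounding property gives `Ent(exp (l f)) ≤ 2 φ(-l) 𝔼[f exp (l f)]` (`entropy_exp_le`).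

In terms of `K` this is the differential inequality `(l - 2 φ(-l)) K'(l) ≤ K(l)`, valid for `l` of
either sign. The functions `E (l + l² / (1 - 5l/6))` for `0 ≤ l < 6/5` and `E (l + l²)` for `l ≤ 0`
satisfy the reverse inequality and agree with `K` to first order at `0`, hence they dominate `K`
(`nonpos_of_mul_deriv_le`). Chernoff's inequality with `l = δ / (2 + 5δ/6)` and with `l = -δ/2`
then gives the two tail bounds.
-/

/-! ### Entropy on a two-point space -/

/-- The entropy `E[Y log Y] - E[Y] log E[Y]` of a random variable `Y` that takes the value `a` with
probability `p` and the value `b` with probability `1 - p`. -/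
noncomputable def twoPointEntropy (p a b : ℝ) : ℝ :=
  p * (a * Real.log a) + (1 - p) * (b * Real.log b) -
    (p * a + (1 - p) * b) * Real.log (p * a + (1 - p) * b)

lemma weighted_pos {p a b : ℝ} (hp : p ∈ Set.Icc (0 : ℝ) 1) (ha : 0 < a) (hb : 0 < b) :
    0 < p * a + (1 - p) * b := by
  obtain ⟨h0, h1⟩ := hp
  rcases h0.eq_or_lt with rfl | h
  · simpa using hb
  · have := mul_pos h ha
    have := mul_nonneg (sub_nonneg.2 h1) hb.le
    linarith

/-- The Gibbs variational principle: the entropy of `Y` dominates `E[Y s]` whenever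
`E[exp s] = 1`. -/
lemma le_twoPointEntropy {p a b s t : ℝ} (hp : p ∈ Set.Icc (0 : ℝ) 1) (ha : 0 < a) (hb : 0 < b)
    (hst : p * Real.exp s + (1 - p) * Real.exp t = 1) :
    p * (a * s) + (1 - p) * (b * t) ≤ twoPointEntropy p a b := by
  have hm := weighted_pos hp ha hb
  obtain ⟨h0, h1⟩ := hp
  unfold twoPointEntropy
  set m := p * a + (1 - p) * b with hm'
  have key : ∀ c u : ℝ, 0 < c → c * u ≤ c * Real.log c - c * Real.log m + m * Real.exp u - c := by
    intro c u hc
    have h := Real.log_le_sub_one_of_pos (x := m * Real.exp u / c) (by positivity)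
    rw [Real.log_div (by positivity) hc.ne', Real.log_mul hm.ne' (Real.exp_pos _).ne',
      Real.log_exp] at h
    have h2 := mul_le_mul_of_nonneg_left h hc.le
    have h3 : c * (m * Real.exp u / c - 1) = m * Real.exp u - c := by field_simp
    rw [h3] at h2
    linarith
  have h2 := mul_le_mul_of_nonneg_left (key a s ha) h0
  have h3 := mul_le_mul_of_nonneg_left (key b t hb) (sub_nonneg.2 h1)
  have h4 : p * (m * Real.exp s) + (1 - p) * (m * Real.exp t) = m := by
    linear_combination m * hst
  have h5 : m * Real.log m = p * (a * Real.log m) + (1 - p) * (b * Real.log m) := by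
    rw [hm']; ring
  linarith

/-- The entropy is jointly convex in the two values, being a supremum of linear functions. -/
lemma twoPointEntropy_convex {p q a a' b b' : ℝ} (hp : p ∈ Set.Icc (0 : ℝ) 1)
    (hq : q ∈ Set.Icc (0 : ℝ) 1) (ha : 0 < a) (ha' : 0 < a') (hb : 0 < b) (hb' : 0 < b') :
    twoPointEntropy p (q * a + (1 - q) * a') (q * b + (1 - q) * b') ≤
      q * twoPointEntropy p a b + (1 - q) * twoPointEntropy p a' b' := by
  have hA := weighted_pos hq ha ha'
  have hB := weighted_pos hq hb hb'
  set A := q * a + (1 - q) * a' with hA'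
  set B := q * b + (1 - q) * b' with hB'
  have hm := weighted_pos hp hA hB
  set m := p * A + (1 - p) * B with hm'
  -- the optimal test values for the mixture also serve as test values for its two components
  have hst : p * Real.exp (Real.log A - Real.log m) +
      (1 - p) * Real.exp (Real.log B - Real.log m) = 1 := by
    rw [Real.exp_sub, Real.exp_sub, Real.exp_log hA, Real.exp_log hB, Real.exp_log hm]
    field_simp
    linarith
  have h1 := mul_le_mul_of_nonneg_left (le_twoPointEntropy hp ha hb hst) hq.1
  have h2 := mul_le_mul_of_nonneg_left (le_twoPointEntropy hp ha' hb' hst) (sub_nonneg.2 hq.2)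
  have h3 : twoPointEntropy p A B = p * (A * (Real.log A - Real.log m)) +
      (1 - p) * (B * (Real.log B - Real.log m)) := by
    unfold twoPointEntropy
    rw [← hm', show m * Real.log m = (p * A + (1 - p) * B) * Real.log m by rw [hm']]
    ring
  rw [h3]
  refine le_trans (le_of_eq ?_) (add_le_add h1 h2)
  conv_lhs => rw [hA', hB']
  ring

lemma twoPointEntropy_self (p a : ℝ) : twoPointEntropy p a a = 0 := by
  unfold twoPointEntropy
  rw [show p * a + (1 - p) * a = a by ring]
  ring

/-- The function `φ(x) = exp x - x - 1`. -/
noncomputable def expRemainder (x : ℝ) : ℝ := Real.exp x - x - 1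

lemma expRemainder_nonneg (x : ℝ) : 0 ≤ expRemainder x := by
  unfold expRemainder
  linarith [Real.add_one_le_exp x]

/-- As `φ` is convex and vanishes at `0`, it lies below its chord on `[0, x]`. -/
lemma expRemainder_mul_le {u : ℝ} (hu : u ∈ Set.Icc (0 : ℝ) 1) (x : ℝ) :
    expRemainder (x * u) ≤ u * expRemainder x := by
  unfold expRemainder
  have h := convexOn_exp.2 (Set.mem_univ x) (Set.mem_univ 0) hu.1 (sub_nonneg.2 hu.2)
    (by ring : u + (1 - u) = 1)
  simp only [smul_eq_mul, mul_zero, add_zero, Real.exp_zero, mul_one] at h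
  rw [mul_comm x u]
  linarith

/-- The two-point modified logarithmic Sobolev inequality. -/
lemma twoPointEntropy_exp_le {p x y m : ℝ} (hp : p ∈ Set.Icc (0 : ℝ) 1)
    (hx : x - m ∈ Set.Icc (0 : ℝ) 1) (hy : y - m ∈ Set.Icc (0 : ℝ) 1) (l : ℝ) :
    twoPointEntropy p (Real.exp (l * x)) (Real.exp (l * y)) ≤ expRemainder (-l) *
      (p * (Real.exp (l * x) * (x - m)) + (1 - p) * (Real.exp (l * y) * (y - m))) := by
  have hM := weighted_pos hp (Real.exp_pos (l * x)) (Real.exp_pos (l * y))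
  have key : ∀ z, z - m ∈ Set.Icc (0 : ℝ) 1 →
      Real.exp (l * z) * (l * z - l * m) - Real.exp (l * z) + Real.exp (l * m) ≤
        expRemainder (-l) * (Real.exp (l * z) * (z - m)) := by
    intro z hz
    have h := mul_le_mul_of_nonneg_left (expRemainder_mul_le hz (-l)) (Real.exp_pos (l * z)).le
    have h2 : Real.exp (l * z) * expRemainder (-l * (z - m)) =
        Real.exp (l * z) * (l * z - l * m) - Real.exp (l * z) + Real.exp (l * m) := by
      have : Real.exp (l * m) = Real.exp (l * z) * Real.exp (-l * (z - m)) := by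
        rw [← Real.exp_add]; ring_nf
      rw [this, expRemainder]; ring
    rw [h2] at h
    linarith
  have h1 := mul_le_mul_of_nonneg_left (key x hx) hp.1
  have h2 := mul_le_mul_of_nonneg_left (key y hy) (sub_nonneg.2 hp.2)
  unfold twoPointEntropy
  rw [Real.log_exp, Real.log_exp]
  set M := p * Real.exp (l * x) + (1 - p) * Real.exp (l * y) with hM'
  have h3 := Real.log_le_sub_one_of_pos (x := Real.exp (l * m) / M) (by positivity)
  rw [Real.log_div (Real.exp_pos _).ne' hM.ne', Real.log_exp] at h3
  have h4 := mul_le_mul_of_nonneg_left h3 hM.le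
  have h5 : M * (Real.exp (l * m) / M - 1) = Real.exp (l * m) - M := by field_simp
  rw [h5] at h4
  have h6 : M * (l * m) = p * (Real.exp (l * x) * (l * m)) +
    (1 - p) * (Real.exp (l * y) * (l * m)) := by rw [hM']; ring
  linarith

/-! ### Averaging over coordinates and tensorization of the entropy -/

section Averaging

variable {N : Type*} [DecidableEq N] {p : N → ℝ}

/-- The conditional expectation of `g S` given all coordinates of the random set `S` except `i`,
where `i` belongs to `S` with probability `p i`. -/
def avg (p : N → ℝ) (i : N) (g : Finset N → ℝ) (S : Finset N) : ℝ :=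
  p i * g (insert i S) + (1 - p i) * g (S.erase i)

/-- Averaging over all the coordinates in a list. -/
def avgList (p : N → ℝ) (l : List N) (g : Finset N → ℝ) : Finset N → ℝ :=
  l.foldr (avg p) g

@[simp] lemma avgList_nil (g : Finset N → ℝ) : avgList p [] g = g := rfl

@[simp] lemma avgList_cons (i : N) (l : List N) (g : Finset N → ℝ) :
    avgList p (i :: l) g = avg p i (avgList p l g) := rfl

lemma insert_erase_eq_insert (i : N) (S : Finset N) : insert i (S.erase i) = insert i S := by
  ext x
  by_cases x = i <;> simp_all

lemma avg_insert (i : N) (g : Finset N → ℝ) (S : Finset N) :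
    avg p i g (insert i S) = avg p i g S := by
  simp [avg]

lemma avg_erase (i : N) (g : Finset N → ℝ) (S : Finset N) :
    avg p i g (S.erase i) = avg p i g S := by
  simp [avg, insert_erase_eq_insert]

lemma avg_eq_self {i : N} {g : Finset N → ℝ} (h1 : ∀ S, g (insert i S) = g S)
    (h2 : ∀ S, g (S.erase i) = g S) : avg p i g = g := by
  funext S
  rw [avg, h1, h2]
  ring

lemma avg_avg (i : N) (g : Finset N → ℝ) : avg p i (avg p i g) = avg p i g :=
  avg_eq_self (avg_insert i g) (avg_erase i g)

lemma avg_comm (i j : N) (g : Finset N → ℝ) :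
    avg p i (avg p j g) = avg p j (avg p i g) := by
  rcases eq_or_ne i j with rfl | hij
  · rfl
  funext S
  simp only [avg]
  rw [Finset.insert_comm j i, Finset.erase_right_comm, Finset.erase_insert_of_ne hij,
    Finset.erase_insert_of_ne hij.symm]
  ring

lemma avg_avgList (i : N) (l : List N) (g : Finset N → ℝ) :
    avg p i (avgList p l g) = avgList p l (avg p i g) := by
  induction l with
  | nil => rfl
  | cons j l ih => rw [avgList_cons, avgList_cons, avg_comm, ih]

lemma avgList_avg_of_mem {i : N} {l : List N} (hi : i ∈ l) (g : Finset N → ℝ) :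
    avgList p l (avg p i g) = avgList p l g := by
  induction l with
  | nil => simp at hi
  | cons j l ih =>
    rcases eq_or_ne i j with rfl | hij
    · rw [avgList_cons, ← avg_avgList, avg_avg, avgList_cons]
    · rw [avgList_cons, avgList_cons, ih ((List.mem_cons.1 hi).resolve_left hij)]

lemma avg_add (i : N) (g h : Finset N → ℝ) :
    avg p i (fun S => g S + h S) = fun S => avg p i g S + avg p i h S := by
  funext S; simp only [avg]; ring

lemma avg_mul_left (i : N) (c : ℝ) (g : Finset N → ℝ) :
    avg p i (fun S => c * g S) = fun S => c * avg p i g S := by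
  funext S; simp only [avg]; ring

lemma avgList_add (l : List N) (g h : Finset N → ℝ) :
    avgList p l (fun S => g S + h S) = fun S => avgList p l g S + avgList p l h S := by
  induction l with
  | nil => rfl
  | cons j l ih => rw [avgList_cons, ih, avg_add]; rfl

lemma avgList_mul_left (l : List N) (c : ℝ) (g : Finset N → ℝ) :
    avgList p l (fun S => c * g S) = fun S => c * avgList p l g S := by
  induction l with
  | nil => rfl
  | cons j l ih => rw [avgList_cons, ih, avg_mul_left]; rfl

lemma avgList_list_sum {ι : Type*} (l : List N) (L : List ι) (g : ι → Finset N → ℝ)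
    (S : Finset N) :
    avgList p l (fun S => (L.map fun i => g i S).sum) S =
      (L.map fun i => avgList p l (g i) S).sum := by
  induction L with
  | nil => simpa using congrFun (avgList_mul_left (p := p) l 0 fun _ => 0) S
  | cons i L ih => simp only [List.map_cons, List.sum_cons, avgList_add, ih]

lemma avg_mono (hp : ∀ i, p i ∈ Set.Icc (0 : ℝ) 1) (i : N) {g h : Finset N → ℝ}
    (hgh : ∀ S, g S ≤ h S) (S : Finset N) : avg p i g S ≤ avg p i h S :=
  add_le_add (mul_le_mul_of_nonneg_left (hgh _) (hp i).1)
    (mul_le_mul_of_nonneg_left (hgh _) (sub_nonneg.2 (hp i).2))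

lemma avgList_mono (hp : ∀ i, p i ∈ Set.Icc (0 : ℝ) 1) (l : List N) {g h : Finset N → ℝ}
    (hgh : ∀ S, g S ≤ h S) (S : Finset N) : avgList p l g S ≤ avgList p l h S := by
  induction l generalizing S with
  | nil => exact hgh S
  | cons j l ih => exact avg_mono hp j ih S

lemma avgList_pos (hp : ∀ i, p i ∈ Set.Icc (0 : ℝ) 1) (l : List N) {g : Finset N → ℝ}
    (hg : ∀ S, 0 < g S) (S : Finset N) : 0 < avgList p l g S := by
  induction l generalizing S with
  | nil => exact hg S
  | cons j l ih => exact weighted_pos (hp j) (ih _) (ih _)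

lemma avgList_insert {i : N} {l : List N} (hi : i ∈ l) (g : Finset N → ℝ) (S : Finset N) :
    avgList p l g (insert i S) = avgList p l g S := by
  rw [← avgList_avg_of_mem hi, ← avg_avgList, avg_insert]

/-- Averaging over all coordinates leaves a constant function. -/
lemma avgList_eq_empty {l : List N} (hl : ∀ i, i ∈ l) (g : Finset N → ℝ) (S : Finset N) :
    avgList p l g S = avgList p l g ∅ := by
  induction S using Finset.induction_on with
  | empty => rfl
  | insert i S _ ih => rw [avgList_insert (hl i), ih]

/-- The entropy of `Y` with respect to the coordinate `i`, as a function of the others. -/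
noncomputable def coordEntropy (p : N → ℝ) (i : N) (Y : Finset N → ℝ) (S : Finset N) : ℝ :=
  twoPointEntropy (p i) (Y (insert i S)) (Y (S.erase i))

lemma avg_coordEntropy (i : N) (Y : Finset N → ℝ) :
    avg p i (coordEntropy p i Y) = coordEntropy p i Y :=
  avg_eq_self (fun S => by simp [coordEntropy])
    (fun S => by simp [coordEntropy, insert_erase_eq_insert])

lemma coordEntropy_nonneg (hp : ∀ i, p i ∈ Set.Icc (0 : ℝ) 1) (i : N) {Y : Finset N → ℝ}
    (hY : ∀ S, 0 < Y S) (S : Finset N) : 0 ≤ coordEntropy p i Y S := by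
  have := le_twoPointEntropy (s := 0) (t := 0) (hp i) (hY (insert i S)) (hY (S.erase i))
    (by simp)
  simpa [coordEntropy] using this

/-- Averaging over one coordinate decreases the entropy with respect to another one. -/
lemma coordEntropy_avg_le (hp : ∀ i, p i ∈ Set.Icc (0 : ℝ) 1) (i j : N) {Y : Finset N → ℝ}
    (hY : ∀ S, 0 < Y S) (S : Finset N) :
    coordEntropy p i (avg p j Y) S ≤ avg p j (coordEntropy p i Y) S := by
  rcases eq_or_ne i j with rfl | hij
  · rw [avg_coordEntropy, coordEntropy, avg_insert, avg_erase, twoPointEntropy_self]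
    exact coordEntropy_nonneg hp i hY S
  · have h := twoPointEntropy_convex (hp i) (hp j) (hY (insert j (insert i S)))
      (hY ((insert i S).erase j)) (hY (insert j (S.erase i))) (hY ((S.erase i).erase j))
    simp only [coordEntropy, avg]
    rw [Finset.insert_comm i j, Finset.erase_right_comm (a := j) (b := i),
      Finset.erase_insert_of_ne hij.symm, ← Finset.erase_insert_of_ne hij]
    exact h

lemma coordEntropy_avgList_le (hp : ∀ i, p i ∈ Set.Icc (0 : ℝ) 1) (i : N) (l : List N)
    {Y : Finset N → ℝ} (hY : ∀ S, 0 < Y S) (S : Finset N) :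
    coordEntropy p i (avgList p l Y) S ≤ avgList p l (coordEntropy p i Y) S := by
  induction l generalizing S with
  | nil => exact le_rfl
  | cons j l ih =>
    exact (coordEntropy_avg_le hp i j (avgList_pos hp l hY) S).trans (avg_mono hp j ih S)

/-- Tensorization of the entropy: the entropy of a function of independent coordinates is at most
the expected sum of its entropies with respect to the single coordinates. -/
lemma entropy_tensorization (hp : ∀ i, p i ∈ Set.Icc (0 : ℝ) 1) (l : List N)
    {Y : Finset N → ℝ} (hY : ∀ S, 0 < Y S) (S : Finset N) :
    avgList p l (fun S => Y S * Real.log (Y S)) S ≤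
      avgList p l Y S * Real.log (avgList p l Y S) +
        (l.map fun i => avgList p l (coordEntropy p i Y) S).sum := by
  induction l generalizing S with
  | nil => simp
  | cons j l ih =>
    have h1 := avg_mono hp j ih S
    simp only [avg_add] at h1
    have h2 := coordEntropy_avgList_le hp j l hY S
    have h3 : coordEntropy p j (avgList p l Y) S =
        avg p j (fun S => avgList p l Y S * Real.log (avgList p l Y S)) S -
          avg p j (avgList p l Y) S * Real.log (avg p j (avgList p l Y) S) := rfl
    have h4 : avg p j (fun S => (l.map fun i => avgList p l (coordEntropy p i Y) S).sum) S =
        (l.map fun i => avg p j (avgList p l (coordEntropy p i Y)) S).sum :=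
      avgList_list_sum [j] l _ S
    rw [h4] at h1
    simp only [avgList_cons, List.map_cons, List.sum_cons]
    rw [avg_avgList j l (coordEntropy p j Y), avg_coordEntropy]
    linarith

end Averaging

/-! ### Submodular functions are self-bounding -/

section Submodular

variable {N : Type*} [DecidableEq N] {f : Finset N → ℝ}

/-- The smaller of the two values that `f` takes when the membership of `i` is varied. -/
def coordMin (f : Finset N → ℝ) (i : N) (S : Finset N) : ℝ :=
  min (f (insert i S)) (f (S.erase i))

lemma sub_coordMin_mem (hf : ∀ A j, marginalValue f A j ∈ Set.Icc (-1 : ℝ) 1) (i : N)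
    (S : Finset N) :
    f (insert i S) - coordMin f i S ∈ Set.Icc (0 : ℝ) 1 ∧
      f (S.erase i) - coordMin f i S ∈ Set.Icc (0 : ℝ) 1 := by
  have h := hf (S.erase i) i
  have e : S.erase i ∪ {i} = insert i S := by ext x; by_cases x = i <;> simp_all
  rw [marginalValue, e, Set.mem_Icc] at h
  unfold coordMin
  simp only [Set.mem_Icc]
  rcases min_cases (f (insert i S)) (f (S.erase i)) with ⟨h1, h2⟩ | ⟨h1, h2⟩ <;> rw [h1] <;>
    refine ⟨⟨?_, ?_⟩, ?_, ?_⟩ <;> linarith [h.1, h.2]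

/-- Remove the elements of `T` from `S` one at a time: by submodularity each removal decreases `f` by
at least as much as the removal of the same element from `S` itself. -/
lemma sum_erase_le (hf : IsSubmodular f) (S T : Finset N) (hT : T ⊆ S) :
    ∑ i ∈ T, (f S - f (S.erase i)) ≤ f S - f (S \ T) := by
  induction T using Finset.induction_on with
  | empty => simp
  | insert i T hi ih =>
    rw [Finset.sum_insert hi]
    have hiS : i ∈ S := hT (Finset.mem_insert_self _ _)
    have h := hf (S.erase i) (S \ T)
    have e1 : S.erase i ∪ S \ T = S := by
      ext x; by_cases x = i <;> simp_all
    have e2 : S.erase i ∩ (S \ T) = S \ insert i T := by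
      ext x; simp only [Finset.mem_inter, Finset.mem_erase, Finset.mem_sdiff, Finset.mem_insert]
      tauto
    rw [e1, e2] at h
    have := ih fun x hx => hT (Finset.mem_insert_of_mem hx)
    linarith

/-- Insert the elements of `T` into `S` one at a time: by submodularity each insertion decreases `f`
by at least as much as the insertion of the same element into `S` itself. -/
lemma sum_insert_le (hf : IsSubmodular f) (S T : Finset N) (hT : Disjoint S T) :
    ∑ i ∈ T, (f S - f (insert i S)) ≤ f S - f (S ∪ T) := by
  induction T using Finset.induction_on with
  | empty => simp
  | insert i T hi ih =>
    rw [Finset.sum_insert hi]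
    rw [Finset.disjoint_insert_right] at hT
    have h := hf (insert i S) (S ∪ T)
    have e1 : insert i S ∪ (S ∪ T) = S ∪ insert i T := by
      ext x; simp only [Finset.mem_union, Finset.mem_insert]; tauto
    have e2 : insert i S ∩ (S ∪ T) = S := by
      ext x; by_cases x = i <;> simp_all
    rw [e1, e2] at h
    have := ih hT.2
    linarith

/-- A nonnegative submodular function satisfies the self-bounding property
`∑ i, (f S - min f) ≤ 2 f S`. One `f S` pays for the elements whose removal decreases `f`, the
other one for those whose insertion decreases it. -/
lemma sum_sub_coordMin_le [Fintype N] (hf0 : ∀ A, 0 ≤ f A) (hf : IsSubmodular f) (S : Finset N) :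
    ∑ i, (f S - coordMin f i S) ≤ 2 * f S := by
  have h1 := sum_erase_le hf S (S.filter fun i => f (S.erase i) ≤ f S) (Finset.filter_subset _ _)
  have h2 := sum_insert_le hf S (Sᶜ.filter fun i => f (insert i S) ≤ f S)
    (Finset.disjoint_of_subset_right (Finset.filter_subset _ _) disjoint_compl_right)
  rw [Finset.sum_filter] at h1 h2
  rw [← Finset.sum_add_sum_compl S]
  have e1 : ∑ i ∈ S, (f S - coordMin f i S) =
      ∑ i ∈ S, if f (S.erase i) ≤ f S then f S - f (S.erase i) else 0 := by
    refine Finset.sum_congr rfl fun i hi => ?_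
    rw [coordMin, Finset.insert_eq_of_mem hi]
    split_ifs with h
    · rw [min_eq_right h]
    · rw [min_eq_left (le_of_not_ge h), sub_self]
  have e2 : ∑ i ∈ Sᶜ, (f S - coordMin f i S) =
      ∑ i ∈ Sᶜ, if f (insert i S) ≤ f S then f S - f (insert i S) else 0 := by
    refine Finset.sum_congr rfl fun i hi => ?_
    rw [coordMin, Finset.erase_eq_of_notMem (Finset.mem_compl.1 hi)]
    split_ifs with h
    · rw [min_eq_left h]
    · rw [min_eq_right (le_of_not_ge h), sub_self]
  rw [e1, e2]
  linarith [hf0 (S \ S.filter fun i => f (S.erase i) ≤ f S),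
    hf0 (S ∪ Sᶜ.filter fun i => f (insert i S) ≤ f S)]

/-- The entropy of `exp (l f)` is at most `2 φ(-l) E[f exp (l f)]`, for `l` of either sign. -/
lemma entropy_exp_le [Fintype N] {p : N → ℝ} (hp : ∀ i, p i ∈ Set.Icc (0 : ℝ) 1)
    (hf0 : ∀ A, 0 ≤ f A) (hf : IsSubmodular f)
    (hfm : ∀ A j, marginalValue f A j ∈ Set.Icc (-1 : ℝ) 1) (l : ℝ) (S : Finset N) :
    l * avgList p Finset.univ.toList (fun S => f S * Real.exp (l * f S)) S -
        avgList p Finset.univ.toList (fun S => Real.exp (l * f S)) S *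
          Real.log (avgList p Finset.univ.toList (fun S => Real.exp (l * f S)) S) ≤
      2 * expRemainder (-l) *
        avgList p Finset.univ.toList (fun S => f S * Real.exp (l * f S)) S := by
  set L := (Finset.univ : Finset N).toList with hL
  have hmem : ∀ i, i ∈ L := fun i => by simp [hL]
  have h1 := entropy_tensorization hp L (fun S => Real.exp_pos (l * f S)) S
  simp only [Real.log_exp] at h1
  have e1 : (fun S => Real.exp (l * f S) * (l * f S)) =
      fun S => l * (f S * Real.exp (l * f S)) := by funext S; ring
  simp only [e1, avgList_mul_left] at h1
  have h2 : ∀ i, avgList p L (coordEntropy p i fun S => Real.exp (l * f S)) S ≤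
      expRemainder (-l) *
        avgList p L (fun S => Real.exp (l * f S) * (f S - coordMin f i S)) S := by
    intro i
    have h3 : ∀ S, coordEntropy p i (fun S => Real.exp (l * f S)) S ≤ expRemainder (-l) *
        avg p i (fun S => Real.exp (l * f S) * (f S - coordMin f i S)) S := by
      intro S
      obtain ⟨hx, hy⟩ := sub_coordMin_mem hfm i S
      have := twoPointEntropy_exp_le (hp i) hx hy l
      simpa [coordEntropy, avg, coordMin, insert_erase_eq_insert] using this
    have h4 := avgList_mono hp L h3 S
    simp only [avgList_mul_left, avgList_avg_of_mem (hmem i)] at h4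
    exact h4
  have h5 : (L.map fun i => avgList p L (coordEntropy p i fun S => Real.exp (l * f S)) S).sum ≤
      (L.map fun i => expRemainder (-l) *
        avgList p L (fun S => Real.exp (l * f S) * (f S - coordMin f i S)) S).sum :=
    List.sum_le_sum fun i _ => h2 i
  rw [List.sum_map_mul_left (f := fun i =>
    avgList p L (fun S => Real.exp (l * f S) * (f S - coordMin f i S)) S),
    ← avgList_list_sum (g := fun i S => Real.exp (l * f S) * (f S - coordMin f i S))] at h5
  have h6 : avgList p L (fun S => (L.map fun i =>
      Real.exp (l * f S) * (f S - coordMin f i S)).sum) S ≤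
      avgList p L (fun S => 2 * (f S * Real.exp (l * f S))) S := by
    refine avgList_mono hp L (fun S => ?_) S
    rw [List.sum_map_mul_left, hL, Finset.sum_map_toList]
    have := mul_le_mul_of_nonneg_left (sum_sub_coordMin_le hf0 hf S) (Real.exp_pos (l * f S)).le
    linarith
  simp only [avgList_mul_left] at h6
  have h7 := mul_le_mul_of_nonneg_left h6 (expRemainder_nonneg (-l))
  linarith

end Submodular

/-! ### A differential comparison principle -/

/-- If `k D' ≤ D` on `(0, R)`, where `k` is positive and `k s ≥ s - s²`, and if `D` and its derivative
vanish at `0`, then `D ≤ 0`. The reason is that `D` times the integrating factor `exp (-∫ 1/k)` is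
antitone, while the lower bound on `k` makes this factor `O(1/s)` at `0`, so that the product tends
to `0` there. -/
lemma nonpos_of_mul_deriv_le {R : ℝ} {k D D' : ℝ → ℝ}
    (hk : ContinuousOn k (Set.Ioo 0 R)) (hkpos : ∀ s ∈ Set.Ioo 0 R, 0 < k s)
    (hk1 : ∀ s ∈ Set.Ioo 0 R, s - s ^ 2 ≤ k s)
    (hD : ∀ s ∈ Set.Ioo 0 R, HasDerivAt D (D' s) s)
    (hDk : ∀ s ∈ Set.Ioo 0 R, k s * D' s ≤ D s)
    (hD0 : D 0 = 0) (hD0' : HasDerivAt D 0 0) {x : ℝ} (hx : x ∈ Set.Ioo 0 R) : D x ≤ 0 := by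
  obtain ⟨F, hF⟩ : ∃ F : ℝ → ℝ, ∀ s ∈ Set.Ioo 0 R, HasDerivAt F (k s)⁻¹ s := by
    refine ⟨fun s => ∫ t in x..s, (k t)⁻¹, fun s hs => ?_⟩
    have hc : ContinuousOn (fun t => (k t)⁻¹) (Set.Ioo 0 R) :=
      hk.inv₀ fun t ht => (hkpos t ht).ne'
    refine intervalIntegral.integral_hasDerivAt_right ?_ ?_ ?_
    · exact (hc.mono (Set.OrdConnected.uIcc_subset Set.ordConnected_Ioo hx hs)).intervalIntegrable
    · exact hc.stronglyMeasurableAtFilter isOpen_Ioo s hs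
    · exact hc.continuousAt (isOpen_Ioo.mem_nhds hs)
  have hE : ∀ s ∈ Set.Ioo 0 R,
      HasDerivAt (fun s => Real.exp (-F s)) (Real.exp (-F s) * -(k s)⁻¹) s :=
    fun s hs => (hF s hs).neg.exp
  have hW : ∀ s ∈ Set.Ioo 0 R, HasDerivAt (fun s => D s * Real.exp (-F s))
      (D' s * Real.exp (-F s) + D s * (Real.exp (-F s) * -(k s)⁻¹)) s :=
    fun s hs => (hD s hs).mul (hE s hs)
  have hanti : AntitoneOn (fun s => D s * Real.exp (-F s)) (Set.Ioo 0 R) := by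
    refine antitoneOn_of_deriv_nonpos (convex_Ioo 0 R)
      (fun s hs => (hW s hs).continuousAt.continuousWithinAt) ?_ ?_
    · rw [interior_Ioo]
      exact fun s hs => (hW s hs).differentiableAt.differentiableWithinAt
    · rw [interior_Ioo]
      intro s hs
      rw [(hW s hs).deriv]
      have hk0 := hkpos s hs
      have : D' s * Real.exp (-F s) + D s * (Real.exp (-F s) * -(k s)⁻¹) =
          -((D s - k s * D' s) * (k s)⁻¹ * Real.exp (-F s)) := by field_simp; ring
      rw [this, neg_nonpos]
      have := sub_nonneg.2 (hDk s hs)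
      positivity
  set r := min x (1 / 2) with hr
  have hr0 : 0 < r := lt_min hx.1 (by norm_num)
  have hsub : Set.Ioc 0 r ⊆ Set.Ioo 0 R := fun s hs =>
    ⟨hs.1, (hs.2.trans (min_le_left _ _)).trans_lt hx.2⟩
  -- `u = s / (1 - s)` solves `(s - s²) u' = u`; its product with the integrating factor is monotone,
  -- which bounds that factor by a constant times `1 / s`
  have hU : ∀ s ∈ Set.Ioc 0 r, HasDerivAt (fun s => Real.exp (-F s) * (s / (1 - s)))
      (Real.exp (-F s) * -(k s)⁻¹ * (s / (1 - s)) +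
        Real.exp (-F s) * ((1 * (1 - s) - s * -1) / (1 - s) ^ 2)) s := by
    intro s hs
    have hs1 : (1 : ℝ) - s ≠ 0 := by
      have := hs.2.trans (min_le_right _ _)
      intro h; linarith
    exact (hE s (hsub hs)).mul ((hasDerivAt_id s).div ((hasDerivAt_id s).const_sub 1) hs1)
  have hmono : MonotoneOn (fun s => Real.exp (-F s) * (s / (1 - s))) (Set.Ioc 0 r) := by
    refine monotoneOn_of_deriv_nonneg (convex_Ioc 0 r)
      (fun s hs => (hU s hs).continuousAt.continuousWithinAt) ?_ ?_
    · exact fun s hs =>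
        (hU s (interior_subset hs)).differentiableAt.differentiableWithinAt
    · intro s hs
      replace hs := interior_subset hs
      rw [(hU s hs).deriv]
      have hs1 : 0 < 1 - s := by
        have := hs.2.trans (min_le_right _ _)
        linarith
      have hk0 := hkpos s (hsub hs)
      have : Real.exp (-F s) * -(k s)⁻¹ * (s / (1 - s)) +
          Real.exp (-F s) * ((1 * (1 - s) - s * -1) / (1 - s) ^ 2) =
          Real.exp (-F s) * (k s)⁻¹ * (k s - (s - s ^ 2)) / (1 - s) ^ 2 := by
        field_simp; ring
      rw [this]
      have := sub_nonneg.2 (hk1 s (hsub hs))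
      positivity
  set C := Real.exp (-F r) * (r / (1 - r)) with hC
  have hbound : ∀ s ∈ Set.Ioc 0 r, D x * Real.exp (-F x) ≤ C * (|D s| / s) := by
    intro s hs
    have h1 := hanti (hsub hs) hx (hs.2.trans (min_le_left _ _))
    have h2 := hmono hs ⟨hr0, le_rfl⟩ hs.2
    simp only at h1 h2
    have hs0 := hs.1
    have hs1 : 0 < 1 - s := by
      have := hs.2.trans (min_le_right _ _)
      linarith
    have h3 : Real.exp (-F s) * s ≤ C := by
      refine le_trans (mul_le_mul_of_nonneg_left ?_ (Real.exp_pos _).le) h2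
      rw [le_div_iff₀ hs1]
      nlinarith
    have h4 : Real.exp (-F s) ≤ C / s := (le_div_iff₀ hs0).2 h3
    calc D x * Real.exp (-F x) ≤ D s * Real.exp (-F s) := h1
      _ ≤ |D s| * Real.exp (-F s) :=
        mul_le_mul_of_nonneg_right (le_abs_self _) (Real.exp_pos _).le
      _ ≤ |D s| * (C / s) := mul_le_mul_of_nonneg_left h4 (abs_nonneg _)
      _ = C * (|D s| / s) := by ring
  have hlim : Filter.Tendsto (fun s => C * (|D s| / s)) (nhdsWithin 0 (Set.Ioi 0)) (nhds 0) := by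
    have h1 := hD0'.tendsto_slope_zero_right
    simp only [zero_add, hD0, sub_zero, smul_eq_mul] at h1
    have h2 := (h1.abs.const_mul C)
    rw [abs_zero, mul_zero] at h2
    refine h2.congr' ?_
    filter_upwards [self_mem_nhdsWithin] with s hs
    rw [abs_mul, abs_inv, abs_of_pos (Set.mem_Ioi.1 hs)]
    ring
  have h0 : D x * Real.exp (-F x) ≤ 0 := by
    refine ge_of_tendsto hlim ?_
    filter_upwards [Ioc_mem_nhdsGT hr0] with s hs using hbound s hs
  exact nonpos_of_mul_nonpos_left h0 (Real.exp_pos _)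

/-! ### Bounds for the cumulant generating function -/

lemma cubic_le_exp {x : ℝ} (hx : 0 ≤ x) : 1 + x + x ^ 2 / 2 + x ^ 3 / 6 ≤ Real.exp x := by
  have h := Real.sum_le_exp_of_nonneg hx 4
  simp only [Finset.sum_range_succ, Finset.sum_range_zero, Nat.factorial] at h
  norm_num at h
  linarith

lemma expRemainder_neg_le {s : ℝ} (hs : 0 ≤ s) : expRemainder (-s) ≤ s ^ 2 / 2 := by
  unfold expRemainder
  have h1 := cubic_le_exp hs
  have h2 : Real.exp (-s) * (1 + s + s ^ 2 / 2 + s ^ 3 / 6) ≤ 1 := by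
    calc _ ≤ Real.exp (-s) * Real.exp s := mul_le_mul_of_nonneg_left h1 (Real.exp_pos _).le
      _ = 1 := by rw [← Real.exp_add]; simp
  by_contra! hc
  have h3 : 0 < 1 + s + s ^ 2 / 2 + s ^ 3 / 6 := by positivity
  have h4 : 1 - s + s ^ 2 / 2 < Real.exp (-s) := by linarith
  have h5 := mul_lt_mul_of_pos_right h4 h3
  have h6 : 0 ≤ s ^ 3 := by positivity
  have h7 : 0 ≤ s ^ 4 := by positivity
  have h8 : 0 ≤ s ^ 5 := by positivity
  nlinarith

/-- On `(0, 6/5)` the coefficient `s - 2 φ(-s)` of the differential inequality is positive. -/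
lemma sub_expRemainder_pos {s : ℝ} (hs : s ∈ Set.Ioo (0 : ℝ) (6 / 5)) :
    0 < s - 2 * expRemainder (-s) := by
  obtain ⟨h0, h1⟩ := hs
  have h2 := cubic_le_exp h0.le
  have h4 : 1 < Real.exp s * (1 - s / 2) := by
    refine lt_of_lt_of_le ?_ (mul_le_mul_of_nonneg_right h2 (by linarith))
    have : 0 < s ^ 3 := by positivity
    nlinarith
  have h5 : Real.exp (-s) < 1 - s / 2 := by
    have := mul_lt_mul_of_pos_left h4 (Real.exp_pos (-s))
    rwa [← mul_assoc, ← Real.exp_add, neg_add_cancel, Real.exp_zero, one_mul, mul_one] at this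
  unfold expRemainder
  linarith

/-- `s²/(1 - 5s/6)` is a supersolution of the differential inequality on `(0, 6/5)`. After clearing
denominators this compares `exp (-s)` with a quotient of polynomials. -/
lemma upper_supersolution {s : ℝ} (hs : s ∈ Set.Ioo (0 : ℝ) (6 / 5)) :
    s + s ^ 2 / (1 - 5 * s / 6) ≤ (s - 2 * expRemainder (-s)) *
      (1 + (2 * s * (1 - 5 * s / 6) + s ^ 2 * (5 / 6)) / (1 - 5 * s / 6) ^ 2) := by
  obtain ⟨h0, h1⟩ := hs
  have hq : 0 < 1 - 5 * s / 6 := by linarith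
  have hN : 0 ≤ 36 - 24 * s + s ^ 2 + 5 * s ^ 3 := by nlinarith [pow_pos h0 3]
  have hMN : 36 + 12 * s - 5 * s ^ 2 ≤ Real.exp s * (36 - 24 * s + s ^ 2 + 5 * s ^ 3) := by
    refine le_trans ?_ (mul_le_mul_of_nonneg_right (cubic_le_exp h0.le) hN)
    have h4 : 0 < s ^ 4 := by positivity
    have h5 : 0 < s ^ 5 := by positivity
    have h6 : 0 < s ^ 6 := by positivity
    linarith
  have hE : Real.exp (-s) * (36 + 12 * s - 5 * s ^ 2) ≤ 36 - 24 * s + s ^ 2 + 5 * s ^ 3 := by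
    have := mul_le_mul_of_nonneg_left hMN (Real.exp_pos (-s)).le
    rwa [← mul_assoc, ← Real.exp_add, neg_add_cancel, Real.exp_zero, one_mul] at this
  rw [← sub_nonneg]
  have : (s - 2 * expRemainder (-s)) *
      (1 + (2 * s * (1 - 5 * s / 6) + s ^ 2 * (5 / 6)) / (1 - 5 * s / 6) ^ 2) -
      (s + s ^ 2 / (1 - 5 * s / 6)) = (36 - 24 * s + s ^ 2 + 5 * s ^ 3 -
        Real.exp (-s) * (36 + 12 * s - 5 * s ^ 2)) / (18 * (1 - 5 * s / 6) ^ 2) := by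
    unfold expRemainder
    generalize Real.exp (-s) = e
    obtain ⟨q, rfl⟩ : ∃ q, s = 6 * (1 - q) / 5 := ⟨1 - 5 * s / 6, by ring⟩
    rw [show 1 - 5 * (6 * (1 - q) / 5) / 6 = q by ring] at hq ⊢
    field_simp
    ring
  rw [this]
  exact div_nonneg (sub_nonneg.2 hE) (by positivity)

/-- `s²` is a supersolution of the differential inequality for negative arguments `-s`. -/
lemma lower_supersolution {s : ℝ} (hs : 0 < s) :
    -s + s ^ 2 ≤ (s + 2 * expRemainder s) * (-1 + 2 * s) := by
  suffices h : 0 ≤ s ^ 2 + expRemainder s * (4 * s - 2) by linarith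
  rcases le_total (1 / 2) s with h | h
  · have := mul_nonneg (expRemainder_nonneg s) (by linarith : 0 ≤ 4 * s - 2)
    positivity
  · have h1 : expRemainder s ≤ s ^ 2 / 2 + 2 * s ^ 3 / 9 := by
      have hb := Real.exp_bound' hs.le (by linarith) (n := 3) (by norm_num)
      simp only [Finset.sum_range_succ, Finset.sum_range_zero, Nat.factorial] at hb
      norm_num at hb
      unfold expRemainder
      linarith
    have h2 := mul_le_mul_of_nonneg_right h1 (by linarith : 0 ≤ 2 - 4 * s)
    have h3 : 0 < s ^ 3 := by positivity
    have h4 : 0 < s ^ 4 := by positivity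
    linarith

/-- The solution of the differential inequality `(l - 2 φ(-l)) K' ≤ K` for positive arguments. -/
lemma cgf_upper_bound {K K' : ℝ → ℝ} {E : ℝ} (hE : 0 ≤ E) (hK : ∀ l, HasDerivAt K (K' l) l)
    (hK0 : K 0 = 0) (hK0' : K' 0 = E)
    (hKK : ∀ l, (l - 2 * expRemainder (-l)) * K' l ≤ K l) {s : ℝ}
    (hs : s ∈ Set.Ioo (0 : ℝ) (6 / 5)) : K s ≤ E * (s + s ^ 2 / (1 - 5 * s / 6)) := by
  have hB : ∀ s : ℝ, s < 6 / 5 → HasDerivAt (fun s => K s - E * (s + s ^ 2 / (1 - 5 * s / 6)))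
      (K' s - E * (1 + (2 * s * (1 - 5 * s / 6) + s ^ 2 * (5 / 6)) / (1 - 5 * s / 6) ^ 2)) s := by
    intro s hs
    have h1 : HasDerivAt (fun s : ℝ => 1 - 5 * s / 6) (-(5 / 6)) s := by
      have := (((hasDerivAt_id s).const_mul (5 : ℝ)).div_const 6).const_sub 1
      simpa using this
    have h2 : HasDerivAt (fun s : ℝ => s ^ 2) (2 * s) s := by
      simpa using hasDerivAt_pow 2 s
    have h3 := (hK s).sub (((hasDerivAt_id s).add
      (h2.div h1 (by linarith : 1 - 5 * s / 6 ≠ 0))).const_mul E)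
    exact h3.congr_deriv (by ring)
  have h := nonpos_of_mul_deriv_le (R := 6 / 5) (k := fun s => s - 2 * expRemainder (-s))
    (by unfold expRemainder; fun_prop) (fun s hs => sub_expRemainder_pos hs)
    (fun s hs => by linarith [expRemainder_neg_le hs.1.le]) (fun s hs => hB s hs.2)
    (fun s hs => by
      have h1 := hKK s
      have h2 := mul_le_mul_of_nonneg_left (upper_supersolution hs) hE
      linarith)
    (by simp [hK0]) (by simpa [hK0'] using hB 0 (by norm_num)) hs
  linarith

/-- The solution of the differential inequality `(l - 2 φ(-l)) K' ≤ K` for negative arguments. -/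
lemma cgf_lower_bound {K K' : ℝ → ℝ} {E : ℝ} (hE : 0 ≤ E) (hK : ∀ l, HasDerivAt K (K' l) l)
    (hK0 : K 0 = 0) (hK0' : K' 0 = E)
    (hKK : ∀ l, (l - 2 * expRemainder (-l)) * K' l ≤ K l) {s : ℝ} (hs : 0 < s) :
    K (-s) ≤ E * (-s + s ^ 2) := by
  have hB : ∀ s : ℝ, HasDerivAt (fun s => K (-s) - E * (-s + s ^ 2))
      (-K' (-s) - E * (-1 + 2 * s)) s := by
    intro s
    have h1 : HasDerivAt (fun s => K (-s)) (-K' (-s)) s := by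
      exact ((hK (-s)).comp s (hasDerivAt_neg s)).congr_deriv (by ring)
    have h2 : HasDerivAt (fun s : ℝ => s ^ 2) (2 * s) s := by
      simpa using hasDerivAt_pow 2 s
    exact h1.sub (((hasDerivAt_neg s).add h2).const_mul E)
  have h := nonpos_of_mul_deriv_le (R := s + 1) (k := fun s => s + 2 * expRemainder s)
    (by unfold expRemainder; fun_prop)
    (fun s hs => by linarith [hs.1, expRemainder_nonneg s])
    (fun s hs => by nlinarith [hs.1, expRemainder_nonneg s]) (fun s _ => hB s)
    (fun s hs => by
      have h1 := hKK (-s)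
      rw [neg_neg] at h1
      have h2 := mul_le_mul_of_nonneg_left (lower_supersolution hs.1) hE
      linarith)
    (by simp [hK0]) (by simpa [hK0'] using hB 0) (x := s) ⟨hs, by linarith⟩
  linarith

/-! ### Independent Boolean random variables -/

section Probability

variable {Ω : Type*} [MeasurableSpace Ω] {μ : Measure Ω} [IsProbabilityMeasure μ] {n : ℕ}
  {X : Fin n → Ω → Bool}

lemma integrable_comp_cube (hX : ∀ i, Measurable (X i)) (φ : (Fin n → Bool) → ℝ) :
    Integrable (fun ω => φ fun i => X i ω) μ := by
  have hm : Measurable fun ω => φ fun i => X i ω :=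
    (measurable_of_finite φ).comp (measurable_pi_lambda _ hX)
  refine Integrable.of_bound hm.aestronglyMeasurable (∑ x, ‖φ x‖) (ae_of_all _ fun ω => ?_)
  exact Finset.single_le_sum (f := fun x => ‖φ x‖) (fun x _ => norm_nonneg _) (Finset.mem_univ _)

/-- Averaging over one coordinate does not change the expectation. -/
lemma integral_evalCube_avg (hX : ∀ i, Measurable (X i)) (hindep : iIndepFun X μ)
    (g : Finset (Fin n) → ℝ) (i : Fin n) :
    ∫ ω, evalCube (avg (fun i => μ.real {ω | X i ω = true}) i g) (fun j => X j ω) ∂μ =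
      ∫ ω, evalCube g (fun j => X j ω) ∂μ := by
  -- `G b` is `g` with the `i`-th coordinate set to `b`, a function of the other coordinates
  set G : Bool → Ω → ℝ := fun b ω => evalCube g (Function.update (fun j => X j ω) i b) with hG
  set c : Ω → ℝ := fun ω => if X i ω = true then 1 else 0 with hc
  have hins : ∀ ω, g (insert i (Finset.univ.filter fun j => X j ω = true)) = G true ω := by
    intro ω
    simp only [hG, evalCube]
    congr 1
    ext j
    by_cases h : j = i <;> simp [h, Function.update]
  have hera : ∀ ω, g ((Finset.univ.filter fun j => X j ω = true).erase i) = G false ω := by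
    intro ω
    simp only [hG, evalCube]
    congr 1
    ext j
    by_cases h : j = i <;> simp [h, Function.update]
  have hGi : ∀ b, Integrable (G b) μ := fun b =>
    integrable_comp_cube hX fun x => evalCube g (Function.update x i b)
  have hcG : ∀ b, Integrable (fun ω => c ω * G b ω) μ := fun b =>
    integrable_comp_cube hX fun x =>
      (if x i = true then 1 else 0) * evalCube g (Function.update x i b)
  have hci : ∫ ω, c ω ∂μ = μ.real {ω | X i ω = true} := by
    have hms : MeasurableSet {ω | X i ω = true} := hX i (measurableSet_singleton true)
    rw [← integral_indicator_one hms]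
    exact integral_congr_ae (ae_of_all _ fun ω => by simp [hc, Set.indicator])
  have hprod : ∀ b, ∫ ω, c ω * G b ω ∂μ = μ.real {ω | X i ω = true} * ∫ ω, G b ω ∂μ := by
    intro b
    have hI := hindep.indepFun_finset {i} {i}ᶜ disjoint_compl_right hX
    have hI2 := hI.comp
      (φ := fun y => if y ⟨i, Finset.mem_singleton_self i⟩ = true then (1 : ℝ) else 0)
      (ψ := fun y => evalCube g fun j => if h : j ∈ ({i}ᶜ : Finset (Fin n)) then y ⟨j, h⟩ else b)
      (measurable_of_finite _) (measurable_of_finite _)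
    have e : ((fun y : ({i}ᶜ : Finset (Fin n)) → Bool => evalCube g fun j =>
        if h : j ∈ ({i}ᶜ : Finset (Fin n)) then y ⟨j, h⟩ else b) ∘
          fun a (k : ({i}ᶜ : Finset (Fin n))) => X k a) = G b := by
      funext ω
      simp only [hG, Function.comp]
      congr 1
      funext j
      by_cases h : j = i <;> simp [h, Function.update]
    rw [e] at hI2
    rw [← hci]
    exact hI2.integral_fun_mul_eq_mul_integral
      (integrable_comp_cube hX fun x => if x i = true then (1 : ℝ) else 0).aestronglyMeasurable
      (hGi b).aestronglyMeasurable
  have e1 : ∀ ω, evalCube g (fun j => X j ω) = c ω * G true ω + (G false ω - c ω * G false ω) := by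
    intro ω
    have h : ∀ b, X i ω = b → G b ω = evalCube g fun j => X j ω := by
      intro b hb
      simp only [hG, ← hb]
      rw [Function.update_eq_self i fun j => X j ω]
    by_cases hb : X i ω = true
    · simp [hc, hb, h true hb]
    · simp [hc, hb, h false (by simpa using hb)]
  simp_rw [e1]
  have hsub : Integrable (fun ω => G false ω - c ω * G false ω) μ := (hGi false).sub (hcG false)
  rw [integral_add (hcG true) hsub, integral_sub (hGi false) (hcG false),
    hprod, hprod]
  simp_rw [evalCube, avg, hins, hera]
  rw [integral_add ((hGi true).const_mul _) ((hGi false).const_mul _), integral_const_mul,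
    integral_const_mul]
  ring

/-- The iterated average over all coordinates is the expectation. -/
lemma avgList_univ_eq_integral (hX : ∀ i, Measurable (X i)) (hindep : iIndepFun X μ)
    (g : Finset (Fin n) → ℝ) :
    avgList (fun i => μ.real {ω | X i ω = true}) Finset.univ.toList g ∅ =
      ∫ ω, evalCube g (fun j => X j ω) ∂μ := by
  have h : ∀ l : List (Fin n),
      ∫ ω, evalCube (avgList (fun i => μ.real {ω | X i ω = true}) l g) (fun j => X j ω) ∂μ =
        ∫ ω, evalCube g (fun j => X j ω) ∂μ := by
    intro l
    induction l with
    | nil => rfl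
    | cons i l ih => rw [avgList_cons, integral_evalCube_avg hX hindep, ih]
  rw [← h Finset.univ.toList]
  simp only [evalCube]
  simp_rw [avgList_eq_empty (fun i => Finset.mem_toList.2 (Finset.mem_univ i)) g
    (Finset.univ.filter _)]
  simp

end Probability

/-! ### The tail bounds -/

theorem corollary3p4 {Ω : Type*} [MeasurableSpace Ω] (μ : Measure Ω) [IsProbabilityMeasure μ]
    (n : ℕ) (X : Fin n → Ω → Bool) (hX : ∀ i, Measurable (X i)) (hindep : iIndepFun X μ)
    (f : Finset (Fin n) → ℝ) (hf_nonneg : ∀ A, 0 ≤ f A) (hf_sub : IsSubmodular f)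
    (hf_marg : ∀ A j, marginalValue f A j ∈ Set.Icc (-1 : ℝ) 1)
    (Z : Ω → ℝ) (hZ : ∀ ω, Z ω = evalCube f (fun i => X i ω))
    (δ : ℝ) (hδ : 0 < δ) :
    μ.real {ω | Z ω ≥ (1 + δ) * ∫ ω', Z ω' ∂μ}
        ≤ Real.exp (-(δ ^ 2 * ∫ ω', Z ω' ∂μ) / (4 + 5 * δ / 3)) ∧
      μ.real {ω | Z ω ≤ (1 - δ) * ∫ ω', Z ω' ∂μ}
        ≤ Real.exp (-(δ ^ 2 * ∫ ω', Z ω' ∂μ) / 4) := by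
  obtain rfl : Z = fun ω => evalCube f (fun i => X i ω) := funext hZ
  set Z := fun ω => evalCube f (fun i => X i ω) with hZdef
  set E := ∫ ω', Z ω' ∂μ with hEdef
  have hE : 0 ≤ E := integral_nonneg fun ω => hf_nonneg _
  have hint : ∀ l : ℝ, Integrable (fun ω => Real.exp (l * Z ω)) μ := fun l =>
    integrable_comp_cube hX fun x => Real.exp (l * evalCube f x)
  have hset : integrableExpSet Z μ = Set.univ := Set.eq_univ_of_forall hint
  have hpos : ∀ l, 0 < mgf Z μ l := fun l => mgf_pos (hint l)
  set K : ℝ → ℝ := fun l => Real.log (mgf Z μ l) with hKdef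
  set K' : ℝ → ℝ := fun l => (∫ ω, Z ω * Real.exp (l * Z ω) ∂μ) / mgf Z μ l with hK'def
  have hK : ∀ l, HasDerivAt K (K' l) l := fun l =>
    (hasDerivAt_mgf (by rw [hset]; simp)).log (hpos l).ne'
  have hK0 : K 0 = 0 := by simp [hKdef]
  have hK0' : K' 0 = E := by simp [hK'def, hEdef]
  have hKK : ∀ l, (l - 2 * expRemainder (-l)) * K' l ≤ K l := by
    intro l
    have h := entropy_exp_le (p := fun i => μ.real {ω | X i ω = true})
      (fun i => ⟨measureReal_nonneg, measureReal_le_one⟩) hf_nonneg hf_sub hf_marg l ∅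
    rw [avgList_univ_eq_integral hX hindep, avgList_univ_eq_integral hX hindep] at h
    change l * (∫ ω, Z ω * Real.exp (l * Z ω) ∂μ) - mgf Z μ l * Real.log (mgf Z μ l) ≤
      2 * expRemainder (-l) * (∫ ω, Z ω * Real.exp (l * Z ω) ∂μ) at h
    rw [hK'def, hKdef, ← mul_div_assoc, div_le_iff₀ (hpos l)]
    linarith
  have hexp : ∀ l, mgf Z μ l = Real.exp (K l) := fun l => (Real.exp_log (hpos l)).symm
  constructor
  · -- this `s` satisfies `1 - 5 * s / 6 = 2 / (2 + 5 * δ / 6)`, which simplifies the bound on `K`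
    set s := δ / (2 + 5 * δ / 6) with hs
    have hs0 : 0 < s := by positivity
    have hs1 : s < 6 / 5 := by
      rw [hs, div_lt_iff₀ (by positivity)]; linarith
    refine (measure_ge_le_exp_mul_mgf ((1 + δ) * E) hs0.le (hint s)).trans ?_
    rw [hexp, ← Real.exp_add, Real.exp_le_exp]
    have h := cgf_upper_bound hE hK hK0 hK0' hKK ⟨hs0, hs1⟩
    have h1 : 1 - 5 * s / 6 = 2 / (2 + 5 * δ / 6) := by rw [hs]; field_simp; ring
    have h2 : -s * ((1 + δ) * E) + E * (s + s ^ 2 / (1 - 5 * s / 6)) =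
        -(δ ^ 2 * E) / (4 + 5 * δ / 3) := by
      rw [h1, hs]
      field_simp
      ring
    linarith
  · -- `l = -δ / 2` minimizes `-l * (1 - δ) * E + E * (l + l ^ 2)`
    have hs0 : 0 < δ / 2 := by positivity
    refine (measure_le_le_exp_mul_mgf ((1 - δ) * E) (neg_nonpos.2 hs0.le) (hint _)).trans ?_
    rw [hexp, ← Real.exp_add, Real.exp_le_exp]
    have h := cgf_lower_bound hE hK hK0 hK0' hKK hs0
    linarith
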